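/- Let $\mathcal X$ be a measurable space and let $\mathcal B$ be a nonempty class of measurable functions $b:\mathcal X\to\mathbb R$. Let $H_\le(\mathcal B)=\{(x,\theta)\mapsto \mathbf 1[b(x)\le\theta] : b\in\mathcal B\}$ and $H_\ge(\mathcal B)=\{(x,\theta)\mapsto \mathbf 1[b(x)\ge\theta] : b\in\mathcal B\}$ be the corresponding threshold classes, viewed as classes of binary classifiers on $\mathcal X\times\mathbb R$, and let $\mathcal F(\mathcal B)=\{x\mapsto[b_\ell(x),b_u(x)] : b_\ell,b_u\in\mathcal B\}$ be the interval class (an interval $[\ell,u]$ with $u<\ell$ is empty). The interval 0/1-loss of $[\ell,u]$ at a label $y\in\mathbb R$ is $0$ if $y\in[\ell,u]$ and $1$ otherwise; the binary 0/1-loss is $\mathbf 1[y\ne\hat y]$. As usual measurability condition, assume that $H_\le(\mathcal B)$ and $H_\ge(\mathcal B)$ are universally separable: each has a countable subclass such that every member of the class is the pointwise limit of a sequence in the subclass. For a loss and a class $H$ of predictors, $H$ is called $(\varepsilon,\delta)$-PAC-learnable with $n$ samples if there is a learner, mapping samples $S$ of size $n$ to members $f(\cdot\mid S)$ of $H$,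 such that for every distribution $D$ of pairs $(x,y)$ for which some member of $H$ has expected loss $0$, with probability at least $1-\delta$ over $S\sim D^n$ the expected loss of $f(\cdot\mid S)$ under $D$ is at most $\varepsilon$. Let $\varepsilon,\delta\in[0,1]$, and let $m:\mathbb N\to\mathbb N$ be a sample size in terms of the VC dimension: for every $d$, every nonempty, universally separable class of measurable binary classifiers on $\mathcal X\times\mathbb R$ of VC dimension at most $d$ is $(\varepsilon,\delta)$-PAC-learnable under the binary 0/1-loss with $m(d)$ samples. (In particular, a threshold class $H_\le(\mathcal B)$ of VC dimension $k$ is learnable with $m(k)$ samples.) If $H_\le(\mathcal B)$ has finite VC dimension $k$, then $\mathcal F(\mathcal B)$ is $(\varepsilon,\delta)$-PAC-learnable under the interval 0/1-loss with $m(10k)$ samples. Hence, for every $m'\ge m(10k)$, there is a learner $S\mapsto f(\cdot\mid S)\in\mathcal F(\mathcal B)$ on samples of size $m'$ such that for every distribution $D$ on $\mathcal X\times\mathbb R$ for which some $g\in\mathcal F(\mathcal B)$ satisfies $\mathbb P_{(x,y)\sim D}[y\notin g(x)]=0$, $$\mathbb P_{S\sim D^{m'}}\Big[\mathbb P_{(x,y)\sim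 D}\big[y\notin f(x\mid S)\big]\le\varepsilon\Big]\ge 1-\delta .$$ -/

import Mathlib

open MeasureTheory Set Filter
open scoped ENNReal

/-! ### Binary classes: shattering, VC dimension, measurability -/

/-- A class `C` of binary classifiers on `Z` shatters the finite set `T` if every labelling of the
points of `T` is realized by a member of `C`. -/
def Shatters {Z : Type*} (C : Set (Z → Bool)) (T : Finset Z) : Prop :=
  ∀ g : Z → Bool, ∃ h ∈ C, ∀ z ∈ T, h z = g z

/-- The VC dimension: the supremum of the sizes of the finite sets that are shattered. -/
noncomputable def vcDim {Z : Type*} (C : Set (Z → Bool)) : ℕ∞ :=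
  ⨆ (T : Finset Z) (_ : Shatters C T), (T.card : ℕ∞)

/-- Universal separability, the usual measurability condition on a class of classifiers: some
countable subclass is such that each member of the class is the pointwise limit of a sequence in
the subclass (for binary values: at each point the sequence is eventually equal to its limit). -/
def UniversallySeparable {Z : Type*} (C : Set (Z → Bool)) : Prop :=
  ∃ C₀ ⊆ C, C₀.Countable ∧
    ∀ h ∈ C, ∃ u : ℕ → Z → Bool, (∀ n, u n ∈ C₀) ∧ ∀ z, ∀ᶠ n in atTop, u n z = h z

/-! ### Losses, risk and PAC learnability -/

/-- The binary 0/1-loss. -/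
def binaryLoss (y yhat : Bool) : ℝ≥0∞ := if y ≠ yhat then 1 else 0

open Classical in
/-- The interval 0/1-loss of the interval `[I.1, I.2]` (which is empty if `I.2 < I.1`). -/
noncomputable def intervalLoss (y : ℝ) (I : ℝ × ℝ) : ℝ≥0∞ := if y ∈ Icc I.1 I.2 then 0 else 1

/-- The expected loss of the predictor `f` under the distribution `D` of pairs `(x, y)`. -/
noncomputable def risk {X Y P : Type*} [MeasurableSpace X] [MeasurableSpace Y]
    (loss : Y → P → ℝ≥0∞) (D : Measure (X × Y)) (f : X → P) : ℝ≥0∞ :=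
  ∫⁻ p, loss p.2 (f p.1) ∂D

/-- `(ε, δ)`-PAC learnability of the class `H` with `n` samples: some learner, which maps samples
of size `n` to members of `H`, has the property that for every distribution `D` that is realizable
by `H`, the probability over i.i.d. samples that the learned predictor has risk more than `ε` is at
most `δ`. (The measure of the failure set is the outer measure, so nothing is lost if that
set is not measurable: it lies in an event of probability at most `δ`.) -/
def PACLearnable {X Y P : Type*} [MeasurableSpace X] [MeasurableSpace Y]
    (loss : Y → P → ℝ≥0∞) (H : Set (X → P)) (ε δ : ℝ) (n : ℕ) : Prop :=
  ∃ A : (Fin n → X × Y) → (X → P), (∀ S, A S ∈ H) ∧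
    ∀ D : Measure (X × Y), IsProbabilityMeasure D → (∃ h ∈ H, risk loss D h = 0) →
      (Measure.pi fun _ : Fin n => D) {S | ¬ risk loss D (A S) ≤ ENNReal.ofReal ε}
        ≤ ENNReal.ofReal δ

/-- `m` is a sample size in terms of the VC dimension, at accuracy `ε` and confidence `δ`, for
binary classification on `Z`: for each `d`, the (nonempty, measurable, universally separable)
classes of VC dimension at most `d` are `(ε, δ)`-PAC learnable with `m d` samples. -/
def IsVCSampleSize (Z : Type*) [MeasurableSpace Z] (ε δ : ℝ) (m : ℕ → ℕ) : Prop :=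
  ∀ (d : ℕ) (C : Set (Z → Bool)), C.Nonempty → (∀ h ∈ C, Measurable h) →
    UniversallySeparable C → vcDim C ≤ d → PACLearnable binaryLoss C ε δ (m d)

/-! ### Threshold and interval classes over a base class -/

/-- The threshold classifiers `(x, θ) ↦ 1[b x ≤ θ]`, for `b` in the base class. -/
noncomputable def thresholdLE {X : Type*} (B : Set (X → ℝ)) : Set (X × ℝ → Bool) :=
  {h | ∃ b ∈ B, h = fun p => decide (b p.1 ≤ p.2)}

/-- The threshold classifiers `(x, θ) ↦ 1[b x ≥ θ]`, for `b` in the base class. -/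
noncomputable def thresholdGE {X : Type*} (B : Set (X → ℝ)) : Set (X × ℝ → Bool) :=
  {h | ∃ b ∈ B, h = fun p => decide (b p.1 ≥ p.2)}

/-- The interval predictors `x ↦ [bl x, bu x]`, for `bl` and `bu` in the base class; an interval is
given by the pair of its end points. -/
def intervalClass {X : Type*} (B : Set (X → ℝ)) : Set (X → ℝ × ℝ) :=
  {f | ∃ bl ∈ B, ∃ bu ∈ B, f = fun x => (bl x, bu x)}

/-! An interval predictor errs at `(x, y)` exactly when the classifier
`(x, θ) ↦ 1[bl x ≤ θ] ∧ 1[bu x ≥ θ]` answers `false` there. So learning intervals is learning, from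
samples all of whose labels are `true`, the class of conjunctions of a member of `thresholdLE B` with
a member of `thresholdGE B` (`pacLearnable_intervalClass`). Both threshold classes have VC dimension
at most `k`: a finite set shattered by `thresholdGE B` is shattered by `thresholdLE B` once all its
thresholds are lowered by a small constant (`Shatters.exists_thresholdLE`). By the Sauer–Shelah lemma each of them therefore has
at most `∑ i ≤ k, (10 k).choose i ≤ (10 * 1.1 ^ 10) ^ k < 2 ^ (5 k)` traces on `10 k` points if `k ≥ 1`,
so the conjunctions have fewer than `2 ^ (10 k)` traces and shatter no set of that size
(`vcDim_conjClass_le`). Extra samples can be ignored (`PACLearnable.mono`). -/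

/-! ### Traces on finite sets and the VC dimension of conjunctions -/

theorem vcDim_le_iff {Z : Type*} {C : Set (Z → Bool)} {d : ℕ} :
    vcDim C ≤ d ↔ ∀ T : Finset Z, Shatters C T → T.card ≤ d := by
  simp [vcDim]

theorem Shatters.mono {Z : Type*} {C : Set (Z → Bool)} {S T : Finset Z} (h : Shatters C T)
    (hST : S ⊆ T) : Shatters C S := fun g =>
  let ⟨f, hf, hfg⟩ := h g
  ⟨f, hf, fun z hz => hfg z (hST hz)⟩

open Classical in
/-- The traces of a class of classifiers on the finite set `T`, each given as the set of points of
`T` with label `true`. They are sets in the subtype of `T`, so that Mathlib's Sauer–Shelah lemma, which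
is about a finite ground type, applies. -/
noncomputable def traces {Z : Type*} (C : Set (Z → Bool)) (T : Finset Z) : Finset (Finset T) :=
  Finset.univ.filter fun S => ∃ h ∈ C, ∀ z : T, h z = true ↔ z ∈ S

theorem mem_traces {Z : Type*} {C : Set (Z → Bool)} {T : Finset Z} {S : Finset T} :
    S ∈ traces C T ↔ ∃ h ∈ C, ∀ z : T, h z = true ↔ z ∈ S := by
  simp [traces]

theorem card_traces_of_shatters {Z : Type*} {C : Set (Z → Bool)} {T : Finset Z}
    (h : Shatters C T) : (traces C T).card = 2 ^ T.card := by
  classical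
  have : traces C T = Finset.univ := by
    ext S
    simp only [mem_traces, Finset.mem_univ, iff_true]
    obtain ⟨f, hf, hfg⟩ := h fun z => decide (∃ hz : z ∈ T, (⟨z, hz⟩ : T) ∈ S)
    refine ⟨f, hf, fun z => ?_⟩
    rw [hfg z z.2]
    simp
  rw [this, Finset.card_univ, Fintype.card_finset, Fintype.card_coe]

/-- The Sauer–Shelah lemma. -/
theorem card_traces_le {Z : Type*} {C : Set (Z → Bool)} {d : ℕ} (hC : vcDim C ≤ d)
    (T : Finset Z) : (traces C T).card ≤ ∑ i ∈ Finset.Iic d, T.card.choose i := by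
  classical
  have hvc : (traces C T).vcDim ≤ d := by
    refine Finset.sup_le fun s hs => ?_
    rw [Finset.mem_shatterer] at hs
    have hsh : Shatters C (s.map (Function.Embedding.subtype _)) := by
      intro g
      obtain ⟨u, hu, hsu⟩ := hs (Finset.filter_subset (fun z : T => g z = true) s)
      obtain ⟨h, hh, hhu⟩ := mem_traces.1 hu
      refine ⟨h, hh, fun z hz => ?_⟩
      obtain ⟨w, hw, rfl⟩ := Finset.mem_map.1 hz
      have := congrArg (w ∈ ·) hsu
      simp only [Finset.mem_inter, Finset.mem_filter, hw, true_and, ← hhu w, eq_iff_iff] at this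
      exact Bool.eq_iff_iff.2 this
    simpa using vcDim_le_iff.1 hC _ hsh
  calc (traces C T).card ≤ (traces C T).shatterer.card := Finset.card_le_card_shatterer _
    _ ≤ ∑ i ∈ Finset.Iic (traces C T).vcDim, (Fintype.card T).choose i :=
        Finset.card_shatterer_le_sum_vcDim
    _ ≤ ∑ i ∈ Finset.Iic d, T.card.choose i := by
        rw [Fintype.card_coe]
        exact Finset.sum_le_sum_of_subset (Finset.Iic_subset_Iic.2 hvc)

/-- The class of conjunctions of a classifier in `C₁` with one in `C₂`. -/
def conjClass {Z : Type*} (C₁ C₂ : Set (Z → Bool)) : Set (Z → Bool) :=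
  Set.image2 (fun h₁ h₂ z => h₁ z && h₂ z) C₁ C₂

theorem card_traces_conjClass_le {Z : Type*} (C₁ C₂ : Set (Z → Bool)) (T : Finset Z) :
    (traces (conjClass C₁ C₂) T).card ≤ (traces C₁ T).card * (traces C₂ T).card := by
  classical
  refine le_trans (Finset.card_le_card (t := Finset.image₂ (· ∩ ·) (traces C₁ T) (traces C₂ T))
    fun S hS => ?_) (Finset.card_image₂_le _ _ _)
  obtain ⟨_, ⟨h₁, hh₁, h₂, hh₂, rfl⟩, hS⟩ := mem_traces.1 hS
  refine Finset.mem_image₂.2 ⟨Finset.univ.filter fun z => h₁ z = true,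
    mem_traces.2 ⟨h₁, hh₁, by simp⟩, Finset.univ.filter fun z => h₂ z = true,
    mem_traces.2 ⟨h₂, hh₂, by simp⟩, ?_⟩
  ext z
  simp [← hS z]

/-- The sum is at most `∑ i, 10 ^ (k - i) * (10 * k).choose i`, extended to all `i ≤ 10 * k`, which is
`10 ^ k * 1.1 ^ (10 * k)` by the binomial theorem, and `10 * 1.1 ^ 10 < 26`. -/
theorem sum_choose_ten_mul_lt {k : ℕ} (hk : k ≠ 0) :
    ∑ i ∈ Finset.Iic k, (10 * k).choose i < 32 ^ k := by
  have key : ((∑ i ∈ Finset.Iic k, (10 * k).choose i : ℕ) : ℝ) < (32 : ℝ) ^ k := by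
    calc ((∑ i ∈ Finset.Iic k, (10 * k).choose i : ℕ) : ℝ)
        = ∑ i ∈ Finset.Iic k, ((10 * k).choose i : ℝ) := by push_cast; rfl
      _ ≤ ∑ i ∈ Finset.Iic k, 10 ^ k * ((1 / 10 : ℝ) ^ i * (10 * k).choose i) := by
          refine Finset.sum_le_sum fun i hi => ?_
          rw [← mul_assoc]
          refine le_mul_of_one_le_left (by positivity) ?_
          rw [one_div, inv_pow, ← div_eq_mul_inv, one_le_div (by positivity)]
          exact pow_le_pow_right₀ (by norm_num) (Finset.mem_Iic.1 hi)
      _ ≤ ∑ i ∈ Finset.range (10 * k + 1), 10 ^ k * ((1 / 10 : ℝ) ^ i * (10 * k).choose i) := by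
          refine Finset.sum_le_sum_of_subset_of_nonneg (fun i hi => ?_) fun _ _ _ => by positivity
          have := Finset.mem_Iic.1 hi
          exact Finset.mem_range.2 (by omega)
      _ = 10 ^ k * (1 / 10 + 1 : ℝ) ^ (10 * k) := by
          rw [add_pow, Finset.mul_sum]
          simp
      _ = (10 * (1 / 10 + 1 : ℝ) ^ 10) ^ k := by rw [pow_mul, mul_pow]
      _ < 32 ^ k := pow_lt_pow_left₀ (by norm_num) (by positivity) hk
  exact_mod_cast key

theorem vcDim_conjClass_le {Z : Type*} {C₁ C₂ : Set (Z → Bool)} {k : ℕ}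
    (h₁ : vcDim C₁ ≤ k) (h₂ : vcDim C₂ ≤ k) : vcDim (conjClass C₁ C₂) ≤ (10 * k : ℕ) := by
  refine vcDim_le_iff.2 fun T hT => ?_
  have bound : ∀ S : Finset Z, Shatters (conjClass C₁ C₂) S →
      2 ^ S.card ≤ (∑ i ∈ Finset.Iic k, S.card.choose i) ^ 2 := fun S hS => by
    rw [← card_traces_of_shatters hS, sq]
    exact (card_traces_conjClass_le C₁ C₂ S).trans
      (Nat.mul_le_mul (card_traces_le h₁ S) (card_traces_le h₂ S))
  rcases eq_or_ne k 0 with rfl | hk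
  · have hIic : Finset.Iic 0 = ({0} : Finset ℕ) := rfl
    have := bound T hT
    rw [hIic, Finset.sum_singleton, Nat.choose_zero_right, one_pow] at this
    by_contra! hlt
    exact absurd this (not_le.2 (Nat.one_lt_two_pow (by omega)))
  · by_contra! hlt
    obtain ⟨S, hST, hS⟩ := Finset.exists_subset_card_eq hlt.le
    have := bound S (hT.mono hST)
    rw [hS] at this
    refine absurd this (not_le.2 ?_)
    calc (∑ i ∈ Finset.Iic k, (10 * k).choose i) ^ 2 < (32 ^ k) ^ 2 :=
          Nat.pow_lt_pow_left (sum_choose_ten_mul_lt hk) two_ne_zero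
      _ = 2 ^ (10 * k) := by
          rw [show (32 : ℕ) = 2 ^ 5 by norm_num, ← pow_mul, ← pow_mul]
          congr 1
          ring

theorem UniversallySeparable.conjClass {Z : Type*} {C₁ C₂ : Set (Z → Bool)}
    (h₁ : UniversallySeparable C₁) (h₂ : UniversallySeparable C₂) :
    UniversallySeparable (conjClass C₁ C₂) := by
  obtain ⟨D₁, hD₁, hc₁, hu₁⟩ := h₁
  obtain ⟨D₂, hD₂, hc₂, hu₂⟩ := h₂
  refine ⟨_root_.conjClass D₁ D₂, Set.image2_subset hD₁ hD₂, hc₁.image2 hc₂ _, ?_⟩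
  rintro _ ⟨f₁, hf₁, f₂, hf₂, rfl⟩
  obtain ⟨u, hu, hul⟩ := hu₁ f₁ hf₁
  obtain ⟨v, hv, hvl⟩ := hu₂ f₂ hf₂
  refine ⟨fun n z => u n z && v n z, fun n => Set.mem_image2_of_mem (hu n) (hv n), fun z => ?_⟩
  filter_upwards [hul z, hvl z] with n h h'
  rw [h, h']

/-! ### The two threshold classes -/

/-- On finitely many points, for the finitely many base functions that realize the labellings,
`b x < θ` is the same as `b x ≤ θ - η` once `η > 0` is small. As `b x < θ` is the negation of
`b x ≥ θ`, the set with all thresholds lowered by `η` is shattered by `thresholdLE B`. -/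
theorem Shatters.exists_thresholdLE {X : Type*} {B : Set (X → ℝ)} {T : Finset (X × ℝ)}
    (hT : Shatters (thresholdGE B) T) :
    ∃ T' : Finset (X × ℝ), T'.card = T.card ∧ Shatters (thresholdLE B) T' := by
  classical
  have hb : ∀ S : Finset (X × ℝ), ∃ b ∈ B, ∀ p ∈ T, b p.1 < p.2 ↔ p ∈ S := fun S => by
    obtain ⟨_, ⟨b, hbB, rfl⟩, hbS⟩ := hT fun p => !decide (p ∈ S)
    refine ⟨b, hbB, fun p hp => ?_⟩
    have : decide (b p.1 ≥ p.2) = !decide (p ∈ S) := hbS p hp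
    rw [← not_le, ← ge_iff_le, ← decide_eq_true_iff (p := b p.1 ≥ p.2), this]
    simp
  choose b hbB hbS using hb
  have hη : ∀ᶠ η in nhdsWithin (0 : ℝ) (Ioi 0),
      ∀ S ∈ T.powerset, ∀ p ∈ T, b S p.1 < p.2 → b S p.1 ≤ p.2 - η := by
    simp only [Filter.eventually_all_finset]
    intro S _ p _
    by_cases hlt : b S p.1 < p.2
    · filter_upwards [Ioo_mem_nhdsGT (sub_pos.2 hlt)] with η h _
      linarith [h.2]
    · exact Eventually.of_forall fun _ h => absurd h hlt
  obtain ⟨η, hη, hη0⟩ := (hη.and self_mem_nhdsWithin).exists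
  have hη0 : 0 < η := hη0
  let e : X × ℝ ↪ X × ℝ := ⟨fun p => (p.1, p.2 - η), fun p q h => by
    simp only [Prod.mk.injEq, sub_left_inj] at h
    exact Prod.ext h.1 h.2⟩
  refine ⟨T.map e, Finset.card_map _, fun g => ?_⟩
  let S := T.filter fun p => g (e p) = true
  refine ⟨_, ⟨b S, hbB S, rfl⟩, fun z hz => ?_⟩
  obtain ⟨p, hp, rfl⟩ := Finset.mem_map.1 hz
  have h₁ : b S p.1 ≤ p.2 - η ↔ b S p.1 < p.2 :=
    ⟨fun h => by linarith, hη S (Finset.mem_powerset.2 (Finset.filter_subset _ _)) p hp⟩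
  have h₂ : p ∈ S ↔ g (e p) = true := by simp [S, hp]
  rw [Bool.eq_iff_iff, decide_eq_true_iff, ← h₂, ← hbS S p hp]
  exact h₁

theorem vcDim_thresholdGE_le {X : Type*} {B : Set (X → ℝ)} {k : ℕ}
    (h : vcDim (thresholdLE B) ≤ k) : vcDim (thresholdGE B) ≤ k :=
  vcDim_le_iff.2 fun _ hT =>
    let ⟨_, hcard, hT'⟩ := hT.exists_thresholdLE
    hcard ▸ vcDim_le_iff.1 h _ hT'

theorem measurable_of_mem_conjClass_threshold {X : Type*} [MeasurableSpace X] {B : Set (X → ℝ)}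
    (hB : ∀ b ∈ B, Measurable b) {h : X × ℝ → Bool}
    (hh : h ∈ conjClass (thresholdLE B) (thresholdGE B)) : Measurable h := by
  obtain ⟨_, ⟨bl, hbl, rfl⟩, _, ⟨bu, hbu, rfl⟩, rfl⟩ := hh
  have hl : Measurable fun p : X × ℝ => bl p.1 := (hB bl hbl).comp measurable_fst
  have hu : Measurable fun p : X × ℝ => bu p.1 := (hB bu hbu).comp measurable_fst
  refine measurable_to_bool ?_
  have : (fun p : X × ℝ => decide (bl p.1 ≤ p.2) && decide (bu p.1 ≥ p.2)) ⁻¹' {true}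
      = {p | bl p.1 ≤ p.2} ∩ {p | p.2 ≤ bu p.1} := by
    ext p
    simp
  rw [this]
  exact (measurableSet_le hl measurable_snd).inter (measurableSet_le measurable_snd hu)

/-! ### Learning intervals from positive samples -/

theorem map_pi_comp_injective {ι κ Z : Type*} [Fintype ι] [Fintype κ] [MeasurableSpace Z]
    (D : Measure Z) [IsProbabilityMeasure D] {e : ι → κ} (he : Function.Injective e) :
    (Measure.pi fun _ : κ => D).map (fun S i => S (e i)) = Measure.pi fun _ : ι => D := by
  classical
  refine (Measure.pi_eq fun s hs => ?_).symm
  rw [Measure.map_apply (by fun_prop) (MeasurableSet.univ_pi hs)]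
  -- A box over `ι` pulls back to the box over `κ` whose sides off the range of `e` are everything.
  have hpre : (fun (S : κ → Z) i => S (e i)) ⁻¹' univ.pi s
      = univ.pi fun j => ⋂ (i) (_ : e i = j), s i := by
    ext S
    simp only [Set.mem_preimage, Set.mem_univ_pi, Set.mem_iInter]
    exact ⟨fun h j i hij => hij ▸ h i, fun h i => h _ i rfl⟩
  rw [hpre, Measure.pi_pi]
  refine (Fintype.prod_of_injective e he _ _ (fun j hj => ?_) fun i => ?_).symm
  · have : ⋂ (i) (_ : e i = j), s i = univ := by
      simp only [iInter_eq_univ]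
      exact fun i hi => absurd ⟨i, hi⟩ hj
    rw [this, measure_univ]
  · congr 1
    ext z
    simp [he.eq_iff]

theorem PACLearnable.mono {X Y P : Type*} [MeasurableSpace X] [MeasurableSpace Y]
    {loss : Y → P → ℝ≥0∞} {H : Set (X → P)} {ε δ : ℝ} {n n' : ℕ} (h : PACLearnable loss H ε δ n)
    (hn : n ≤ n') : PACLearnable loss H ε δ n' := by
  obtain ⟨A, hA, hfail⟩ := h
  refine ⟨fun S => A fun i => S (Fin.castLE hn i), fun S => hA _, fun D hD hreal => ?_⟩
  refine le_trans ?_ (hfail D hD hreal)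
  rw [← map_pi_comp_injective D (Fin.castLE_injective hn)]
  exact Measure.le_map_apply (f := fun (S : Fin n' → X × Y) i => S (Fin.castLE hn i))
    (Measurable.aemeasurable (by fun_prop)) _

theorem risk_intervalLoss {X : Type*} [MeasurableSpace X] {B : Set (X → ℝ)}
    (hB : ∀ b ∈ B, Measurable b) (D : Measure (X × ℝ)) {f : X → ℝ × ℝ}
    (hf : f ∈ intervalClass B) :
    risk intervalLoss D f = D {p | p.2 ∉ Icc (f p.1).1 (f p.1).2} := by
  obtain ⟨bl, hbl, bu, hbu, rfl⟩ := hf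
  have hl : Measurable fun p : X × ℝ => bl p.1 := (hB bl hbl).comp measurable_fst
  have hu : Measurable fun p : X × ℝ => bu p.1 := (hB bu hbu).comp measurable_fst
  have hm : MeasurableSet {p : X × ℝ | p.2 ∉ Icc (bl p.1) (bu p.1)} :=
    ((measurableSet_le hl measurable_snd).inter (measurableSet_le measurable_snd hu)).compl
  rw [risk, ← lintegral_indicator_one hm]
  refine lintegral_congr fun p => ?_
  by_cases hp : p.2 ∈ Icc (bl p.1) (bu p.1)
  · rw [Set.indicator_of_notMem (by simpa using hp), intervalLoss, if_pos hp]
  · rw [Set.indicator_of_mem (by simpa using hp), intervalLoss, if_neg hp, Pi.one_apply]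

theorem risk_binaryLoss_map_true {X : Type*} [MeasurableSpace X] (D : Measure (X × ℝ))
    {h : X × ℝ → Bool} (hh : Measurable h) {f : X → ℝ × ℝ}
    (hf : ∀ p, h p = true ↔ p.2 ∈ Icc (f p.1).1 (f p.1).2) :
    risk binaryLoss (D.map fun p => (p, true)) h = risk intervalLoss D f := by
  have hloss : Measurable fun q : (X × ℝ) × Bool => binaryLoss q.2 (h q.1) :=
    (measurable_of_countable fun r : Bool × Bool => binaryLoss r.1 r.2).comp
      (measurable_snd.prodMk (hh.comp measurable_fst))
  rw [risk, lintegral_map hloss (by fun_prop), risk]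
  refine lintegral_congr fun p => ?_
  by_cases hp : p.2 ∈ Icc (f p.1).1 (f p.1).2
  · simp [binaryLoss, intervalLoss, (hf p).2 hp, hp]
  · simp [binaryLoss, intervalLoss, (hf p).not.2 hp, hp]

/-- A learner for the conjunctions of threshold classifiers, run on samples with all labels `true`,
learns intervals. -/
theorem pacLearnable_intervalClass {X : Type*} [MeasurableSpace X] {B : Set (X → ℝ)}
    (hB : ∀ b ∈ B, Measurable b) {ε δ : ℝ} {n : ℕ}
    (h : PACLearnable binaryLoss (conjClass (thresholdLE B) (thresholdGE B)) ε δ n) :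
    PACLearnable intervalLoss (intervalClass B) ε δ n := by
  obtain ⟨A, hA, hfail⟩ := h
  have hint : ∀ S, ∃ f ∈ intervalClass B, ∀ p, A S p = true ↔ p.2 ∈ Icc (f p.1).1 (f p.1).2 := by
    intro S
    obtain ⟨_, ⟨bl, hbl, rfl⟩, _, ⟨bu, hbu, rfl⟩, hS⟩ := hA S
    exact ⟨_, ⟨bl, hbl, bu, hbu, rfl⟩, fun p => by simp [← hS]⟩
  choose F hF hAF using hint
  refine ⟨fun S => F fun i => (S i, true), fun S => hF _, fun D hD hreal => ?_⟩
  have hlabel : Measurable fun p : X × ℝ => (p, true) := by fun_prop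
  have hD' : IsProbabilityMeasure (D.map fun p => (p, true)) :=
    Measure.isProbabilityMeasure_map hlabel.aemeasurable
  have hreal' : ∃ h ∈ conjClass (thresholdLE B) (thresholdGE B),
      risk binaryLoss (D.map fun p => (p, true)) h = 0 := by
    obtain ⟨f, ⟨bl, hbl, bu, hbu, rfl⟩, hf⟩ := hreal
    have hmem := Set.mem_image2_of_mem (f := fun (h₁ h₂ : X × ℝ → Bool) z => h₁ z && h₂ z)
      (show _ ∈ thresholdLE B from ⟨bl, hbl, rfl⟩) (show _ ∈ thresholdGE B from ⟨bu, hbu, rfl⟩)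
    refine ⟨_, hmem, ?_⟩
    rw [risk_binaryLoss_map_true D (measurable_of_mem_conjClass_threshold hB hmem)
      (f := fun x => (bl x, bu x)) (by simp), hf]
  refine le_trans ?_ (hfail _ hD' hreal')
  rw [← Measure.pi_map_pi fun _ => hlabel.aemeasurable]
  refine le_trans (measure_mono fun S hS => ?_)
    (Measure.le_map_apply (f := fun (S : Fin n → X × ℝ) i => (S i, true))
      (Measurable.aemeasurable (by fun_prop)) _)
  have := risk_binaryLoss_map_true D (measurable_of_mem_conjClass_threshold hB
    (hA fun i => (S i, true))) (hAF fun i => (S i, true))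
  simp only [Set.mem_preimage, Set.mem_ofPred_eq] at hS ⊢
  rwa [this]

theorem corollary1 {X : Type*} [MeasurableSpace X]
    (B : Set (X → ℝ)) (hB : B.Nonempty) (hBmeas : ∀ b ∈ B, Measurable b)
    (hLE : UniversallySeparable (thresholdLE B)) (hGE : UniversallySeparable (thresholdGE B))
    (k : ℕ) (hk : vcDim (thresholdLE B) = k)
    (ε δ : ℝ) (hε : ε ∈ Icc (0 : ℝ) 1) (hδ : δ ∈ Icc (0 : ℝ) 1)
    (m : ℕ → ℕ) (hm : IsVCSampleSize (X × ℝ) ε δ m) :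
    PACLearnable intervalLoss (intervalClass B) ε δ (m (10 * k)) ∧
    ∀ m' : ℕ, m (10 * k) ≤ m' →
      ∃ f : (Fin m' → X × ℝ) → (X → ℝ × ℝ), (∀ S, f S ∈ intervalClass B) ∧
        ∀ D : Measure (X × ℝ), IsProbabilityMeasure D →
          (∃ g ∈ intervalClass B, D {p | p.2 ∉ Icc (g p.1).1 (g p.1).2} = 0) →
          (Measure.pi fun _ : Fin m' => D)
              {S | ¬ D {p | p.2 ∉ Icc (f S p.1).1 (f S p.1).2} ≤ ENNReal.ofReal ε}
            ≤ ENNReal.ofReal δ := by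
  have hlearn : PACLearnable intervalLoss (intervalClass B) ε δ (m (10 * k)) := by
    obtain ⟨b, hb⟩ := hB
    refine pacLearnable_intervalClass hBmeas (hm _ _ ?_
      (fun _ => measurable_of_mem_conjClass_threshold hBmeas) (hLE.conjClass hGE)
      (vcDim_conjClass_le hk.le (vcDim_thresholdGE_le hk.le)))
    exact ⟨_, Set.mem_image2_of_mem ⟨b, hb, rfl⟩ ⟨b, hb, rfl⟩⟩
  refine ⟨hlearn, fun m' hm' => ?_⟩
  obtain ⟨f, hf, hfail⟩ := hlearn.mono hm'
  refine ⟨f, hf, fun D hD ⟨g, hg, hg0⟩ => ?_⟩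
  simpa only [risk_intervalLoss hBmeas D (hf _)] using
    hfail D hD ⟨g, hg, (risk_intervalLoss hBmeas D hg).trans hg0⟩
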